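/- Let $n$ be a positive integer and $[n]=\{1,\dots,n\}$. A set system $\mathcal{F}\subseteq 2^{[n]}$ shatters $S\subseteq[n]$ if $\{F\cap S : F\in\mathcal{F}\}=2^S$; let $Sh(\mathcal{F})$ denote the family of all sets shattered by $\mathcal{F}$. The system $\mathcal{F}$ is called shattering-extremal if $|Sh(\mathcal{F})|=|\mathcal{F}|$ (in particular, the empty system is shattering-extremal), and the VC-dimension of a nonempty $\mathcal{F}$ is the maximum cardinality of a set shattered by $\mathcal{F}$. Theorem. Let $\mathcal{F}\subseteq 2^{[n]}$ be a nonempty shattering-extremal family of VC-dimension at most $2$. Then there exists $F\in\mathcal{F}$ such that $\mathcal{F}\setminus\{F\}$ is still shattering-extremal. -/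

import Mathlib

/-- A set system `𝓕 ⊆ 2^[n]` is shattering-extremal if it shatters exactly `|𝓕|` sets:
`|Sh(𝓕)| = |𝓕|`. Here `Finset.shatterer` is the family `Sh(𝓕)` of all sets shattered by `𝓕`. -/
def ShatteringExtremal {n : ℕ} (𝓕 : Finset (Finset (Fin n))) : Prop :=
  𝓕.shatterer.card = 𝓕.card

open Finset

variable {n : ℕ}

/-! Deleting a trace corner loses a shattered set, so by Pajor's inequality
(`card_le_card_shatterer`) it preserves extremality. Corners are found by strong induction on a
relative form, `exists_isTraceCorner_notMem`: a proper extremal `T ⊆ C` of VC-dimension at most 1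
misses a corner of `C`. Cut `C` along a coordinate. The halves and the wall are extremal, and the
wall has dimension at most 1, so it can play the role of `T` inside a half; a corner off the wall
survives in `C`. -/

/-- Toggle membership of `j` in `F`. -/
def toggle (j : Fin n) (F : Finset (Fin n)) : Finset (Fin n) := symmDiff F {j}

lemma mem_toggle {i j : Fin n} {F : Finset (Fin n)} :
    i ∈ toggle j F ↔ (i ≠ j ∧ i ∈ F) ∨ (i = j ∧ i ∉ F) := by
  simp only [toggle, mem_symmDiff, mem_singleton]
  tauto

@[simp] lemma toggle_toggle (j : Fin n) (F : Finset (Fin n)) : toggle j (toggle j F) = F := by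
  simp [toggle]

lemma toggle_injective (j : Fin n) : Function.Injective (toggle j) :=
  Function.LeftInverse.injective (toggle_toggle j)

/-- The members of `C` that agree with `w` at `j`. -/
def half (C : Finset (Finset (Fin n))) (j : Fin n) (w : Finset (Fin n)) :
    Finset (Finset (Fin n)) := {F ∈ C | j ∈ F ↔ j ∈ w}

/-- The members of `half C j w` whose toggle at `j` is also in `C`. -/
def wall (C : Finset (Finset (Fin n))) (j : Fin n) (w : Finset (Fin n)) :
    Finset (Finset (Fin n)) := {F ∈ half C j w | toggle j F ∈ C}

lemma mem_half {C : Finset (Finset (Fin n))} {j : Fin n} {w F : Finset (Fin n)} :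
    F ∈ half C j w ↔ F ∈ C ∧ (j ∈ F ↔ j ∈ w) := by simp [half]

lemma mem_wall {C : Finset (Finset (Fin n))} {j : Fin n} {w F : Finset (Fin n)} :
    F ∈ wall C j w ↔ F ∈ C ∧ (j ∈ F ↔ j ∈ w) ∧ toggle j F ∈ C := by
  simp [wall, mem_half, and_assoc]

lemma half_subset (C : Finset (Finset (Fin n))) (j : Fin n) (w : Finset (Fin n)) :
    half C j w ⊆ C := filter_subset _ _

lemma wall_subset_half (C : Finset (Finset (Fin n))) (j : Fin n) (w : Finset (Fin n)) :
    wall C j w ⊆ half C j w := filter_subset _ _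

lemma mem_half_toggle {C : Finset (Finset (Fin n))} {j : Fin n} {w F : Finset (Fin n)} :
    F ∈ half C j (toggle j w) ↔ F ∈ C ∧ ¬ (j ∈ F ↔ j ∈ w) := by
  rw [mem_half, mem_toggle]; tauto

lemma card_half_add_card_half (C : Finset (Finset (Fin n))) (j : Fin n) (w : Finset (Fin n)) :
    #(half C j w) + #(half C j (toggle j w)) = #C := by
  rw [← card_filter_add_card_filter_not (s := C) (fun F => j ∈ F ↔ j ∈ w)]
  congr 2
  ext F
  rw [mem_half_toggle, mem_filter]

lemma Finset.Shatters.image_toggle {B : Finset (Finset (Fin n))} {S : Finset (Fin n)}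
    (h : B.Shatters S) (j : Fin n) : (B.image (toggle j)).Shatters S := by
  intro t ht
  obtain ⟨u, hu, hut⟩ := h (inter_subset_left : S ∩ toggle j t ⊆ S)
  refine ⟨toggle j u, mem_image_of_mem _ hu, ?_⟩
  ext i
  have := congrArg (i ∈ ·) hut
  have hi := @ht i
  simp only [mem_inter, mem_toggle, eq_iff_iff] at *
  tauto

lemma shatters_image_toggle {B : Finset (Finset (Fin n))} {S : Finset (Fin n)} {j : Fin n} :
    (B.image (toggle j)).Shatters S ↔ B.Shatters S := by
  refine ⟨fun h => ?_, fun h => h.image_toggle j⟩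
  have := h.image_toggle j
  rwa [image_image, show toggle j ∘ toggle j = id from funext (toggle_toggle j), image_id] at this

lemma Finset.Shatters.notMem_of_forall {B : Finset (Finset (Fin n))} {S : Finset (Fin n)}
    {j : Fin n} {p : Prop} (h : B.Shatters S) (hB : ∀ F ∈ B, (j ∈ F ↔ p)) : j ∉ S := by
  intro hj
  obtain ⟨u, hu, hu'⟩ := h (singleton_subset_iff.2 hj)
  obtain ⟨v, hv, hv'⟩ := h (empty_subset S)
  have h1 : j ∈ S ∩ u := by simp [hu']
  have h2 : j ∉ S ∩ v := by simp [hv']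
  rw [mem_inter] at h1 h2
  have := hB u hu
  have := hB v hv
  tauto

/-! ### Extremality of halves and walls -/

/-- Identify the two halves of `C` along coordinate `j`. -/
def merge (C : Finset (Finset (Fin n))) (j : Fin n) (w : Finset (Fin n)) :
    Finset (Finset (Fin n)) := half C j w ∪ (half C j (toggle j w)).image (toggle j)

lemma iff_of_mem_merge {C : Finset (Finset (Fin n))} {j : Fin n} {w F : Finset (Fin n)}
    (h : F ∈ merge C j w) : j ∈ F ↔ j ∈ w := by
  rw [merge, mem_union, mem_image] at h
  obtain h | ⟨G, hG, rfl⟩ := h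
  · exact (mem_half.1 h).2
  · have := (mem_half_toggle.1 hG).2
    rw [mem_toggle]; tauto

lemma half_inter_image_toggle (C : Finset (Finset (Fin n))) (j : Fin n) (w : Finset (Fin n)) :
    half C j w ∩ (half C j (toggle j w)).image (toggle j) = wall C j w := by
  ext F
  rw [mem_inter, mem_image, mem_wall, mem_half]
  constructor
  · rintro ⟨h, G, hG, rfl⟩
    exact ⟨h.1, h.2, by simpa using (mem_half.1 hG).1⟩
  · rintro ⟨h1, h2, h3⟩
    refine ⟨⟨h1, h2⟩, toggle j F, mem_half_toggle.2 ⟨h3, ?_⟩, toggle_toggle j F⟩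
    rw [mem_toggle]; tauto

lemma card_merge_add_card_wall (C : Finset (Finset (Fin n))) (j : Fin n) (w : Finset (Fin n)) :
    #(merge C j w) + #(wall C j w) = #C := by
  rw [← half_inter_image_toggle, merge, card_union_add_card_inter,
    card_image_of_injective _ (toggle_injective j), card_half_add_card_half]

lemma Finset.Shatters.insert_of_halves {C : Finset (Finset (Fin n))} {j : Fin n}
    {w S : Finset (Fin n)} (hA : (half C j w).Shatters S)
    (hB : (half C j (toggle j w)).Shatters S) : C.Shatters (insert j S) := by
  have hj : j ∉ S := hA.notMem_of_forall fun F hF => (mem_half.1 hF).2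
  intro t ht
  have key : ∀ u, S ∩ u = t.erase j → (j ∈ u ↔ j ∈ t) → insert j S ∩ u = t := by
    intro u hu hju
    ext i
    have := congrArg (i ∈ ·) hu
    have hi := @ht i
    simp only [mem_inter, mem_erase, mem_insert, eq_iff_iff] at *
    by_cases hij : i = j
    · subst hij; tauto
    · tauto
  have hsub : t.erase j ⊆ S := by rwa [← subset_insert_iff]
  by_cases hjt : j ∈ t ↔ j ∈ w
  · obtain ⟨u, hu, hu'⟩ := hA hsub
    have := mem_half.1 hu
    exact ⟨u, this.1, key u hu' (by tauto)⟩
  · obtain ⟨u, hu, hu'⟩ := hB hsub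
    have := mem_half_toggle.1 hu
    exact ⟨u, this.1, key u hu' (by tauto)⟩

lemma Finset.Shatters.of_merge {C : Finset (Finset (Fin n))} {j : Fin n}
    {w S : Finset (Fin n)} (h : (merge C j w).Shatters S) : C.Shatters S := by
  have hj : j ∉ S := h.notMem_of_forall fun F hF => iff_of_mem_merge hF
  intro t ht
  obtain ⟨u, hu, rfl⟩ := h ht
  rw [merge, mem_union, mem_image] at hu
  obtain hu | ⟨G, hG, rfl⟩ := hu
  · exact ⟨u, (mem_half.1 hu).1, rfl⟩
  · refine ⟨G, (mem_half.1 hG).1, ?_⟩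
    ext i
    simp only [mem_inter, mem_toggle]
    by_cases hij : i = j
    · subst hij; tauto
    · tauto

/-- The two families of shattered sets are told apart by `j`: the first omit it, the second gain it.
-/
lemma card_shatterer_merge_add_le (C : Finset (Finset (Fin n))) (j : Fin n)
    (w : Finset (Fin n)) :
    #(merge C j w).shatterer + #((half C j w).shatterer ∩ (half C j (toggle j w)).shatterer) ≤
      #C.shatterer := by
  have hnot : ∀ S ∈ (half C j w).shatterer ∩ (half C j (toggle j w)).shatterer, j ∉ S := by
    intro S hS
    rw [mem_inter, mem_shatterer] at hS
    exact hS.1.notMem_of_forall fun F hF => (mem_half.1 hF).2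
  rw [← card_image_of_injOn (f := insert j) (s := _ ∩ _), ← card_union_of_disjoint]
  · refine card_le_card (union_subset (fun S hS => ?_) fun S hS => ?_)
    · exact mem_shatterer.2 (mem_shatterer.1 hS).of_merge
    · obtain ⟨R, hR, rfl⟩ := mem_image.1 hS
      simp only [mem_inter, mem_shatterer] at hR ⊢
      exact hR.1.insert_of_halves hR.2
  · rw [disjoint_left]
    intro S hS hS'
    obtain ⟨R, -, rfl⟩ := mem_image.1 hS'
    exact (mem_shatterer.1 hS).notMem_of_forall (fun F hF => iff_of_mem_merge hF)
      (mem_insert_self j R)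
  · intro S hS R hR h
    rw [← erase_insert (hnot S hS), ← erase_insert (hnot R hR)]
    exact congrArg (fun X => erase X j) h

lemma shatterer_half_union_subset (C : Finset (Finset (Fin n))) (j : Fin n)
    (w : Finset (Fin n)) :
    (half C j w).shatterer ∪ (half C j (toggle j w)).shatterer ⊆ (merge C j w).shatterer := by
  refine union_subset (shatterer_mono subset_union_left) fun S hS => ?_
  rw [mem_shatterer] at hS ⊢
  exact (hS.image_toggle j).mono_left subset_union_right

lemma ShatteringExtremal.half {C : Finset (Finset (Fin n))} (h : ShatteringExtremal C)
    (j : Fin n) (w : Finset (Fin n)) : ShatteringExtremal (half C j w) := by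
  have h1 := card_shatterer_merge_add_le C j w
  have h2 := card_le_card (shatterer_half_union_subset C j w)
  have h3 := card_union_add_card_inter (_root_.half C j w).shatterer
    (_root_.half C j (toggle j w)).shatterer
  have h4 := card_half_add_card_half C j w
  have h5 := card_le_card_shatterer (_root_.half C j w)
  have h6 := card_le_card_shatterer (_root_.half C j (toggle j w))
  unfold ShatteringExtremal at *
  omega

lemma shatterer_wall_subset (C : Finset (Finset (Fin n))) (j : Fin n) (w : Finset (Fin n)) :
    (wall C j w).shatterer ⊆
      (half C j w).shatterer ∩ (half C j (toggle j w)).shatterer := by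
  rw [← half_inter_image_toggle]
  refine subset_inter (shatterer_mono inter_subset_left) fun S hS => ?_
  rw [mem_shatterer] at hS ⊢
  exact shatters_image_toggle.1 (hS.mono_left inter_subset_right)

lemma ShatteringExtremal.wall {C : Finset (Finset (Fin n))} (h : ShatteringExtremal C)
    (j : Fin n) (w : Finset (Fin n)) : ShatteringExtremal (wall C j w) := by
  have h1 := card_shatterer_merge_add_le C j w
  have h2 := card_le_card (shatterer_wall_subset C j w)
  have h3 := card_merge_add_card_wall C j w
  have h4 := card_le_card_shatterer (merge C j w)
  have h5 := card_le_card_shatterer (_root_.wall C j w)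
  unfold ShatteringExtremal at *
  omega

/-- Both halves shatter `∅`, so the merge has fewer members than `C`. -/
lemma ShatteringExtremal.wall_nonempty {C : Finset (Finset (Fin n))} (h : ShatteringExtremal C)
    {j : Fin n} {w : Finset (Fin n)} (hA : (_root_.half C j w).Nonempty)
    (hB : (_root_.half C j (toggle j w)).Nonempty) : (_root_.wall C j w).Nonempty := by
  have h1 := card_shatterer_merge_add_le C j w
  have h3 := card_merge_add_card_wall C j w
  have h4 := card_le_card_shatterer (merge C j w)
  have h5 : 0 < #((_root_.half C j w).shatterer ∩ (_root_.half C j (toggle j w)).shatterer) :=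
    card_pos.2 ⟨∅, by simp [hA, hB]⟩
  unfold ShatteringExtremal at h
  exact card_pos.1 (by omega)

/-! ### Corners and how they lift -/

/-- An element of `C` is a corner if it is the only one with its trace on some shattered set. -/
def IsTraceCorner (C : Finset (Finset (Fin n))) (v : Finset (Fin n)) : Prop :=
  v ∈ C ∧ ∃ S, C.Shatters S ∧ ∀ u ∈ C, S ∩ u = S ∩ v → u = v

lemma ShatteringExtremal.sdiff_corner {C : Finset (Finset (Fin n))} {v : Finset (Fin n)}
    (h : ShatteringExtremal C) (hv : IsTraceCorner C v) : ShatteringExtremal (C \ {v}) := by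
  obtain ⟨hvC, S, hS, huniq⟩ := hv
  have hlt : #(C \ {v}).shatterer < #C.shatterer := by
    refine card_lt_card ((ssubset_iff_of_subset (shatterer_mono sdiff_subset)).2
      ⟨S, mem_shatterer.2 hS, fun hS' => ?_⟩)
    obtain ⟨u, hu, hu'⟩ := mem_shatterer.1 hS' (inter_subset_left : S ∩ v ⊆ S)
    rw [mem_sdiff, mem_singleton] at hu
    exact hu.2 (huniq u hu.1 hu')
  have h1 := card_le_card_shatterer (C \ {v})
  have h2 : #(C \ {v}) + 1 = #C := by
    rw [sdiff_singleton_eq_erase, card_erase_add_one hvC]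
  unfold ShatteringExtremal at *
  omega

lemma ShatteringExtremal.fiber {C : Finset (Finset (Fin n))} (h : ShatteringExtremal C)
    (v S : Finset (Fin n)) : ShatteringExtremal {F ∈ C | S ∩ F = S ∩ v} := by
  induction S using Finset.induction_on with
  | empty => simpa using h
  | insert a S ha ih =>
    convert ih.half a v using 1
    ext F
    simp only [mem_half, mem_filter, and_assoc, and_congr_right_iff]
    intro _
    simp only [Finset.ext_iff, mem_inter, mem_insert]
    constructor
    · exact fun H => ⟨fun i => by have := H i; tauto, by have := H a; tauto⟩
    · rintro ⟨H, H'⟩ i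
      have := H i
      by_cases hi : i = a
      · subst hi; tauto
      · tauto

/-- A corner of a half that is off the wall is a corner of the whole family. -/
lemma IsTraceCorner.of_half {C : Finset (Finset (Fin n))} {j : Fin n} {w v : Finset (Fin n)}
    (h : ShatteringExtremal C) (hv : IsTraceCorner (half C j w) v) (hvK : v ∉ wall C j w) :
    IsTraceCorner C v := by
  obtain ⟨hvA, S, hS, huniq⟩ := hv
  have hvC := mem_half.1 hvA
  refine ⟨hvC.1, S, hS.mono_left (half_subset C j w), fun u hu huv => ?_⟩
  by_contra hne
  have hju : ¬ (j ∈ u ↔ j ∈ w) := fun hj => hne (huniq u (mem_half.2 ⟨hu, hj⟩) huv)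
  -- The fiber of the trace of `v` meets both sides, hence has a wall element; uniqueness makes it
  -- `v`.
  obtain ⟨x, hx⟩ := (h.fiber v S).wall_nonempty (j := j) (w := w)
    ⟨v, mem_half.2 ⟨mem_filter.2 ⟨hvC.1, rfl⟩, hvC.2⟩⟩
    ⟨u, mem_half_toggle.2 ⟨mem_filter.2 ⟨hu, huv⟩, hju⟩⟩
  rw [mem_wall, mem_filter, mem_filter] at hx
  obtain ⟨⟨hxC, hxv⟩, hxj, hxt, -⟩ := hx
  obtain rfl := huniq x (mem_half.2 ⟨hxC, hxj⟩) hxv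
  exact hvK (mem_wall.2 ⟨hxC, hxj, hxt⟩)

/-- If a half coincides with its wall, its corners are corners of the whole family. -/
lemma IsTraceCorner.of_wall {C : Finset (Finset (Fin n))} {j : Fin n} {w v : Finset (Fin n)}
    (hv : IsTraceCorner (wall C j w) v) (hK : wall C j w = half C j w) : IsTraceCorner C v := by
  obtain ⟨hvK, S, hS, huniq⟩ := hv
  have hv' := mem_wall.1 hvK
  have hS' := mem_inter.1 (shatterer_wall_subset C j w (mem_shatterer.2 hS))
  refine ⟨hv'.1, insert j S,
    (mem_shatterer.1 hS'.1).insert_of_halves (mem_shatterer.1 hS'.2), fun u hu huv => ?_⟩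
  have hj := congrArg (j ∈ ·) huv
  simp only [mem_inter, mem_insert, true_or, true_and, eq_iff_iff] at hj
  refine huniq u (hK ▸ mem_half.2 ⟨hu, hj.trans hv'.2.1⟩) ?_
  ext i
  have := congrArg (i ∈ ·) huv
  simp only [mem_inter, mem_insert, eq_iff_iff] at this ⊢
  tauto

lemma vcDim_wall_succ_le {C : Finset (Finset (Fin n))} {j : Fin n} {w : Finset (Fin n)}
    (hne : (wall C j w).Nonempty) : (wall C j w).vcDim + 1 ≤ C.vcDim := by
  obtain ⟨S, hS, hcard⟩ := exists_mem_eq_sup (wall C j w).shatterer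
    ⟨∅, by simpa using hne⟩ card
  have hS' := mem_inter.1 (shatterer_wall_subset C j w hS)
  have hj : j ∉ S := (mem_shatterer.1 hS'.1).notMem_of_forall fun F hF => (mem_half.1 hF).2
  have := ((mem_shatterer.1 hS'.1).insert_of_halves (mem_shatterer.1 hS'.2)).card_le_vcDim
  rw [card_insert_of_notMem hj] at this
  rwa [vcDim, hcard]

lemma shatteringExtremal_empty : ShatteringExtremal (∅ : Finset (Finset (Fin n))) := by
  simp [ShatteringExtremal, shatterer]

lemma half_subset_half {C T : Finset (Finset (Fin n))} {j : Fin n} {w : Finset (Fin n)}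
    (hT : T ⊆ C) :
    half T j w ⊆ half C j w := filter_subset_filter _ hT

/-! ### The induction -/

/-- A halfspace meeting `T` in at most one element of the wall has a corner of `C` off `T`,
given the existence of relative corners in smaller families. -/
lemma exists_corner_of_half {C T : Finset (Finset (Fin n))} {j : Fin n} {w : Finset (Fin n)}
    (hC : ShatteringExtremal C) (hdim : C.vcDim ≤ 2)
    (hT : ShatteringExtremal T) (hTdim : T.vcDim ≤ 1)
    (ih : ∀ C' : Finset (Finset (Fin n)), #C' < #C → ∀ T' ⊆ C', T' ≠ C' → ShatteringExtremal C' →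
      C'.vcDim ≤ 2 → ShatteringExtremal T' → T'.vcDim ≤ 1 → ∃ v, IsTraceCorner C' v ∧ v ∉ T')
    (hA : (half C j w).Nonempty) (hB : (half C j (toggle j w)).Nonempty)
    (hTK : half T j w ⊆ wall C j w) (hne : half T j w ≠ half C j w) :
    ∃ v, IsTraceCorner C v ∧ v ∉ T := by
  have hcard := card_half_add_card_half C j w
  have hBpos := card_pos.2 hB
  have hKne := hC.wall_nonempty hA hB
  have hKdim := vcDim_wall_succ_le hKne
  by_cases hK : wall C j w = half C j w
  · obtain ⟨v, hv, hvT⟩ := ih (wall C j w) (by rw [hK]; omega) (half T j w) hTK (by rwa [hK])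
      (hC.wall j w) (by omega) (hT.half j w) ((vcDim_mono (half_subset T j w)).trans hTdim)
    exact ⟨v, hv.of_wall hK, fun h => hvT (mem_half.2 ⟨h, (mem_wall.1 hv.1).2.1⟩)⟩
  · obtain ⟨v, hv, hvK⟩ := ih (half C j w) (by omega) (wall C j w) (wall_subset_half C j w) hK
      (hC.half j w) ((vcDim_mono (half_subset C j w)).trans hdim) (hC.wall j w) (by omega)
    exact ⟨v, hv.of_half hC hvK,
      fun h => hvK (hTK (mem_half.2 ⟨h, (mem_half.1 hv.1).2⟩))⟩

lemma exists_isTraceCorner_notMem (C : Finset (Finset (Fin n))) :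
    ∀ T ⊆ C, T ≠ C → ShatteringExtremal C → C.vcDim ≤ 2 →
      ShatteringExtremal T → T.vcDim ≤ 1 → ∃ v, IsTraceCorner C v ∧ v ∉ T := by
  induction hN : #C using Nat.strong_induction_on generalizing C with
  | _ N ihN =>
  subst hN
  have ih : ∀ C' : Finset (Finset (Fin n)), #C' < #C → ∀ T' ⊆ C', T' ≠ C' →
      ShatteringExtremal C' → C'.vcDim ≤ 2 → ShatteringExtremal T' → T'.vcDim ≤ 1 →
      ∃ v, IsTraceCorner C' v ∧ v ∉ T' := fun C' h => ihN _ h C' rfl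
  intro T hTC hne hC hdim hT hTdim
  obtain ⟨p, hpC, hpT⟩ := exists_of_ssubset (hTC.ssubset_of_ne hne)
  obtain rfl | hTne := T.eq_empty_or_nonempty
  · by_cases hsub : ∀ u ∈ C, u = p
    · exact ⟨p, ⟨hpC, ∅, shatters_empty.2 ⟨p, hpC⟩, fun u hu _ => hsub u hu⟩, hpT⟩
    · push Not at hsub
      obtain ⟨u, hu, hup⟩ := hsub
      obtain ⟨j, hj⟩ : ∃ j, ¬ (j ∈ u ↔ j ∈ p) := by
        by_contra! h
        exact hup (Finset.ext h)
      have hA : (half C j p).Nonempty := ⟨p, mem_half.2 ⟨hpC, Iff.rfl⟩⟩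
      refine exists_corner_of_half hC hdim hT hTdim ih hA
        ⟨u, mem_half_toggle.2 ⟨hu, hj⟩⟩ (by simp [half]) ?_
      simpa [half] using hA.ne_empty.symm
  -- A corner of `T` itself selects the cut: its set `S` has at most one element.
  obtain ⟨x, ⟨hxT, S, hS, huniq⟩, -⟩ := ih T (card_lt_card (hTC.ssubset_of_ne hne)) ∅
    (empty_subset _) hTne.ne_empty.symm hT (hTdim.trans one_le_two) shatteringExtremal_empty
    (by simp [vcDim, shatterer])
  obtain rfl | ⟨j, hjS⟩ := S.eq_empty_or_nonempty
  · -- `T = {x}`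
    obtain ⟨j, hj⟩ : ∃ j, ¬ (j ∈ p ↔ j ∈ x) := by
      by_contra! h
      exact hpT (Finset.ext h ▸ hxT)
    have hempty : half T j p = ∅ := by
      refine eq_empty_of_forall_notMem fun u hu => ?_
      have hu := mem_half.1 hu
      obtain rfl := huniq u hu.1 (by simp)
      tauto
    have hA : (half C j p).Nonempty := ⟨p, mem_half.2 ⟨hpC, Iff.rfl⟩⟩
    refine exists_corner_of_half hC hdim hT hTdim ih hA
      ⟨x, mem_half_toggle.2 ⟨hTC hxT, by tauto⟩⟩ (by simp [hempty]) ?_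
    rw [hempty]
    exact hA.ne_empty.symm
  -- `S = {j}`
  have hSj : S = {j} := by
    have := hS.card_le_vcDim.trans hTdim
    exact (card_eq_one.1 (le_antisymm this (card_pos.2 ⟨j, hjS⟩))).elim fun a ha => by
      subst ha; rw [mem_singleton.1 hjS]
  subst hSj
  have huniq' : ∀ u ∈ half T j x, u = x := fun u hu => by
    have hu := mem_half.1 hu
    refine huniq u hu.1 ?_
    ext i
    simp only [mem_inter, mem_singleton, and_congr_right_iff]
    rintro rfl
    exact hu.2
  have hTA : (half T j x).Nonempty := ⟨x, mem_half.2 ⟨hxT, Iff.rfl⟩⟩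
  have hTB : (half T j (toggle j x)).Nonempty := by
    obtain ⟨u, hu, hu'⟩ := hS (inter_subset_left : {j} ∩ toggle j x ⊆ {j})
    refine ⟨u, mem_half.2 ⟨hu, ?_⟩⟩
    simpa using congrArg (j ∈ ·) hu'
  have hxy : toggle j x ∈ T := by
    obtain ⟨z, hz⟩ := hT.wall_nonempty hTA hTB
    obtain rfl := huniq' z (wall_subset_half _ _ _ hz)
    exact (mem_wall.1 hz).2.2
  have hxK : half T j x ⊆ wall C j x := fun u hu => by
    obtain rfl := huniq' u hu
    exact mem_wall.2 ⟨hTC hxT, Iff.rfl, hTC hxy⟩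
  have hA : (half C j x).Nonempty := hTA.mono (half_subset_half hTC)
  have hB : (half C j (toggle j x)).Nonempty := hTB.mono (half_subset_half hTC)
  by_cases hhalf : half T j x = half C j x
  · -- `x` is pendant in `C`: pass to the other half
    have hcard := card_half_add_card_half C j x
    have hpos := card_pos.2 hA
    have hneB : half T j (toggle j x) ≠ half C j (toggle j x) := by
      intro h
      by_cases hp : j ∈ p ↔ j ∈ x
      · exact hpT (half_subset T j x (hhalf ▸ mem_half.2 ⟨hpC, hp⟩))
      · exact hpT (half_subset T j _ (h ▸ mem_half_toggle.2 ⟨hpC, hp⟩))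
    obtain ⟨v, hv, hvT⟩ := ih (half C j (toggle j x)) (by omega) (half T j (toggle j x))
      (half_subset_half hTC) hneB (hC.half _ _) ((vcDim_mono (half_subset _ _ _)).trans hdim)
      (hT.half _ _) ((vcDim_mono (half_subset _ _ _)).trans hTdim)
    have hvT' : v ∉ T := fun h => hvT (mem_half.2 ⟨h, (mem_half.1 hv.1).2⟩)
    -- If `v` were on the wall, its toggle would be `x`, so `v` would be the toggle of `x`, which
    -- lies in `T`.
    refine ⟨v, hv.of_half hC fun hvK => hvT' ?_, hvT'⟩
    obtain ⟨-, hvj, hvC⟩ := mem_wall.1 hvK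
    have hvx : toggle j v ∈ half T j x := by
      rw [hhalf]
      refine mem_half.2 ⟨hvC, ?_⟩
      rw [mem_toggle] at hvj ⊢
      tauto
    rw [← toggle_toggle j v, huniq' _ hvx]
    exact hxy
  · exact exists_corner_of_half hC hdim hT hTdim ih hA hB hxK hhalf

theorem theorem2 (n : ℕ) (𝓕 : Finset (Finset (Fin n))) (hne : 𝓕.Nonempty)
    (hext : ShatteringExtremal 𝓕) (hvc : 𝓕.vcDim ≤ 2) :
    ∃ F ∈ 𝓕, ShatteringExtremal (𝓕 \ {F}) := by
  obtain ⟨v, hv, -⟩ := exists_isTraceCorner_notMem 𝓕 ∅ (empty_subset _) hne.ne_empty.symm hext hvc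
    shatteringExtremal_empty (by simp [vcDim, shatterer])
  exact ⟨v, hv.1, hext.sdiff_corner hv⟩
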